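/- Let $p$ be a prime, let $m,n,s$ be positive integers, let $\mathbb{F}_{p^m}$ be the field with $p^m$ elements, and let $\mathcal{R}=\mathbb{F}_{p^m}[u]/\langle u^3\rangle$. Let $\alpha_0,\gamma\in\mathbb{F}_{p^m}\setminus\{0\}$ be such that $f(x)=x^n-\alpha_0$ is irreducible over $\mathbb{F}_{p^m}$. Put $\alpha=\alpha_0^{p^s}$, $\lambda=\alpha+\gamma u^2$ and $N=np^s$. A $\lambda$-constacyclic code of length $N$ over $\mathcal{R}$ is an $\mathcal{R}$-submodule $\mathcal{C}$ of $\mathcal{R}^N$ such that $(a_0,\dots,a_{N-1})\in\mathcal{C}$ implies $(\lambda a_{N-1},a_0,\dots,a_{N-2})\in\mathcal{C}$; via $(a_0,\dots,a_{N-1})\mapsto\sum_i a_ix^i$ it is identified with an ideal of $\mathcal{R}_\lambda=\mathcal{R}[x]/\langle x^N-\lambda\rangle$. Its dual is $\mathcal{C}^\perp=\{v\in\mathcal{R}^N:\sum_i v_ic_i=0\text{ for all }c\in\mathcal{C}\}$. The code $\mathcal{C}$ is isodual if it is $\mathcal{R}$-linearly equivalent to $\mathcal{C}^\perp$, i.e.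 if $\mathcal{C}^\perp$ is obtained from $\mathcal{C}$ by a permutation of the coordinates followed by the multiplication of each coordinate by a unit of $\mathcal{R}$. For an ideal $\mathcal{I}$ of $\mathcal{R}_\lambda$ let $\mathrm{Res}_u(\mathcal{I})$, $\mathrm{Tor}_u(\mathcal{I})$ and $\mathrm{Tor}_{u^2}(\mathcal{I})$ be the sets of classes in $\mathbb{F}_{p^m}[x]/\langle f^{p^s}\rangle$ of, respectively, the $a_0$ such that $a_0+ua_1+u^2a_2\in\mathcal{I}$ for some $a_1,a_2$; the $a_1$ such that $ua_1+u^2a_2\in\mathcal{I}$ for some $a_2$; and the $a_2$ such that $u^2a_2\in\mathcal{I}$ (here $a_0,a_1,a_2\in\mathbb{F}_{p^m}[x]$ are zero or have degree less than $N$). These are ideals $\langle f^a\rangle$, $\langle f^b\rangle$, $\langle f^c\rangle$ of $\mathbb{F}_{p^m}[x]/\langle f^{p^s}\rangle$ with $0\le c\le b\le a\le p^s$. A code whose ideal is non-trivial (neither $0$ nor $\mathcal{R}_\lambda$) is of Type I if $a=b=p^s$, of Type II if $a=p^s$ and $b<p^s$, and of Type III if $a<p^s$. Then: (a) There is no isodual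 $\lambda$-constacyclic code of Type I of length $N$ over $\mathcal{R}$. (b) There exists an isodual $\lambda$-constacyclic code of Type II of length $N$ over $\mathcal{R}$ if and only if $p=2$. When $p=2$, the code $\langle u(x^n-\alpha_0)^{2^{s-1}},u^2\rangle$ is the only isodual $\lambda$-constacyclic code of Type II. (c) There exists an isodual $\lambda$-constacyclic code of Type III of length $N$ over $\mathcal{R}$ if and only if $p=2$. When $p=2$, for every integer $a$ with $2^{s-1}\le a<2^s$ the codes $$\big\langle (x^n-\alpha_0)^a+u(x^n-\alpha_0)^{a-2^{s-1}}\gamma^{2^{m-1}}+u^2(x^n-\alpha_0)^{t_2}D_2(x),\; u(x^n-\alpha_0)^{2^{s-1}}+u^2\gamma^{2^{m-1}},\; u^2(x^n-\alpha_0)^{2^s-a}\big\rangle$$ are isodual $\lambda$-constacyclic codes of Type III, where either $D_2=0$, or $0\le t_2<2^s-a$ and $D_2(x)$ is a unit of $\mathcal{R}_\lambda$ of the form $\sum_{\ell=0}^{2^s-a-t_2-1}Q_\ell(x)(x^n-\alpha_0)^\ell$ with each $Q_\ell\in\mathbb{F}_{p^m}[x]$ zero or of degree less than $n$. -/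

import Mathlib

open Polynomial

noncomputable section

namespace Constacyclic

/-! ### Linear codes of length `N` over a commutative ring -/

/-- The `lam`-constacyclic shift
`(a_0, a_1, …, a_{N-1}) ↦ (lam * a_{N-1}, a_0, …, a_{N-2})`. -/
def shift {R : Type*} [CommRing R] {N : ℕ} (lam : R) (a : Fin N → R) : Fin N → R :=
  fun i =>
    if (i : ℕ) = 0 then lam * a ⟨N - 1, by have := i.isLt; omega⟩
    else a ⟨(i : ℕ) - 1, by have := i.isLt; omega⟩

/-- A linear code (submodule of `R^N`) is `lam`-constacyclic if it is stable under the shift. -/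
def IsConstacyclic {R : Type*} [CommRing R] {N : ℕ} (lam : R)
    (C : Submodule R (Fin N → R)) : Prop :=
  ∀ a ∈ C, shift lam a ∈ C

/-- The dual code with respect to the standard bilinear form of `R^N`. -/
def dualCode {R : Type*} [CommRing R] {N : ℕ} (C : Submodule R (Fin N → R)) :
    Submodule R (Fin N → R) where
  carrier := {v | ∀ c ∈ C, ∑ i, v i * c i = 0}
  add_mem' := by
    intro v w hv hw c hc
    simp [add_mul, Finset.sum_add_distrib, hv c hc, hw c hc]
  zero_mem' := by
    intro c _
    simp
  smul_mem' := by
    intro r v hv c hc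
    simp [mul_assoc, ← Finset.mul_sum, hv c hc]

/-- `R`-linear (monomial) equivalence of codes: `D` arises from `C` by permuting the coordinates
and multiplying each coordinate by a unit of `R`. -/
def LinearlyEquivalent {R : Type*} [CommRing R] {N : ℕ} (C D : Submodule R (Fin N → R)) : Prop :=
  ∃ (σ : Equiv.Perm (Fin N)) (d : Fin N → Rˣ),
    ∀ v : Fin N → R, v ∈ D ↔ ∃ c ∈ C, ∀ i, v i = (d i : R) * c (σ i)

/-- A code is isodual if it is linearly equivalent to its dual code. -/
def IsIsodual {R : Type*} [CommRing R] {N : ℕ} (C : Submodule R (Fin N → R)) : Prop :=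
  LinearlyEquivalent C (dualCode C)

/-- The ring `R[x]/⟨x^N - lam⟩`. -/
abbrev QuotRing {R : Type*} [CommRing R] (N : ℕ) (lam : R) : Type _ :=
  AdjoinRoot (X ^ N - C lam : R[X])

/-- The standard map `R^N → R[x]/⟨x^N - lam⟩`,
`(a_0, …, a_{N-1}) ↦ a_0 + a_1 x + ⋯ + a_{N-1} x^{N-1}`. -/
def psi {R : Type*} [CommRing R] (N : ℕ) (lam : R) : (Fin N → R) →ₗ[R] QuotRing N lam :=
  Fintype.linearCombination R
    (fun i : Fin N => (AdjoinRoot.root (X ^ N - C lam : R[X])) ^ (i : ℕ))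

/-- The code of length `N` that is identified with the ideal `I` of `R[x]/⟨x^N - lam⟩`. -/
def codeOfIdeal {R : Type*} [CommRing R] {N : ℕ} {lam : R} (I : Ideal (QuotRing N lam)) :
    Submodule R (Fin N → R) :=
  (I.restrictScalars R).comap (psi N lam)

/-! ### The chain ring `F[u]/⟨u^3⟩` and torsion ideals -/

/-- The ring `F[u]/⟨u^3⟩`. -/
abbrev ChainRing (F : Type*) [Field F] : Type _ := AdjoinRoot (X ^ 3 : F[X])

/-- The element `u` of `F[u]/⟨u^3⟩`. -/
def u (F : Type*) [Field F] : ChainRing F := AdjoinRoot.root (X ^ 3 : F[X])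

/-- The element `α + γ u²` of `F[u]/⟨u^3⟩`. -/
def unitOf {F : Type*} [Field F] (α γ : F) : ChainRing F :=
  algebraMap F (ChainRing F) α + algebraMap F (ChainRing F) γ * u F ^ 2

section Torsion

variable {F : Type*} [Field F] {N : ℕ} {lam : ChainRing F}

/-- The class of a polynomial `a(x) ∈ F[x]` in `R[x]/⟨x^N - lam⟩`, where `R = F[u]/⟨u^3⟩`. -/
def incl (N : ℕ) (lam : ChainRing F) : F[X] →ₐ[F] QuotRing N lam :=
  aeval (AdjoinRoot.root (X ^ N - C lam : (ChainRing F)[X]))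

/-- The element `u` of `R[x]/⟨x^N - lam⟩`, where `R = F[u]/⟨u^3⟩`. -/
def uQ (N : ℕ) (lam : ChainRing F) : QuotRing N lam :=
  algebraMap (ChainRing F) (QuotRing N lam) (u F)

/-- `Res_u(I)`, as a subset of `F[x]/⟨g⟩`. -/
def resU (g : F[X]) (I : Ideal (QuotRing N lam)) : Set (AdjoinRoot g) :=
  {r | ∃ a₀ ∈ degreeLT F N, ∃ a₁ ∈ degreeLT F N, ∃ a₂ ∈ degreeLT F N,
    incl N lam a₀ + uQ N lam * incl N lam a₁ + uQ N lam ^ 2 * incl N lam a₂ ∈ I ∧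
      r = AdjoinRoot.mk g a₀}

/-- `Tor_u(I)`, as a subset of `F[x]/⟨g⟩`. -/
def torU (g : F[X]) (I : Ideal (QuotRing N lam)) : Set (AdjoinRoot g) :=
  {r | ∃ a₁ ∈ degreeLT F N, ∃ a₂ ∈ degreeLT F N,
    uQ N lam * incl N lam a₁ + uQ N lam ^ 2 * incl N lam a₂ ∈ I ∧
      r = AdjoinRoot.mk g a₁}

/-- `Tor_{u²}(I)`, as a subset of `F[x]/⟨g⟩`. -/
def torU2 (g : F[X]) (I : Ideal (QuotRing N lam)) : Set (AdjoinRoot g) :=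
  {r | ∃ a₂ ∈ degreeLT F N, uQ N lam ^ 2 * incl N lam a₂ ∈ I ∧ r = AdjoinRoot.mk g a₂}

/-- `Res_u(I) = ⟨f^a⟩`, `Tor_u(I) = ⟨f^b⟩` and `Tor_{u²}(I) = ⟨f^c⟩` in `F[x]/⟨f^q⟩`, with
`0 ≤ c ≤ b ≤ a ≤ q`. -/
def HasExponents (f : F[X]) (q : ℕ) (I : Ideal (QuotRing N lam)) (a b c : ℕ) : Prop :=
  c ≤ b ∧ b ≤ a ∧ a ≤ q ∧
    resU (f ^ q) I = (Ideal.span {AdjoinRoot.mk (f ^ q) (f ^ a)} : Ideal (AdjoinRoot (f ^ q))) ∧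
    torU (f ^ q) I = (Ideal.span {AdjoinRoot.mk (f ^ q) (f ^ b)} : Ideal (AdjoinRoot (f ^ q))) ∧
    torU2 (f ^ q) I = (Ideal.span {AdjoinRoot.mk (f ^ q) (f ^ c)} : Ideal (AdjoinRoot (f ^ q)))

/-- Codes of Type I: those of non-trivial ideals with `a = b = q`. -/
def IsTypeI (f : F[X]) (q : ℕ) (lam : ChainRing F)
    (K : Submodule (ChainRing F) (Fin N → ChainRing F)) : Prop :=
  ∃ I : Ideal (QuotRing N lam), K = codeOfIdeal I ∧ I ≠ ⊥ ∧ I ≠ ⊤ ∧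
    ∃ c, HasExponents f q I q q c

/-- Codes of Type II: those of non-trivial ideals with `a = q` and `b < q`. -/
def IsTypeII (f : F[X]) (q : ℕ) (lam : ChainRing F)
    (K : Submodule (ChainRing F) (Fin N → ChainRing F)) : Prop :=
  ∃ I : Ideal (QuotRing N lam), K = codeOfIdeal I ∧ I ≠ ⊥ ∧ I ≠ ⊤ ∧
    ∃ b c, b < q ∧ HasExponents f q I q b c

/-- Codes of Type III: those of non-trivial ideals with `a < q`. -/
def IsTypeIII (f : F[X]) (q : ℕ) (lam : ChainRing F)
    (K : Submodule (ChainRing F) (Fin N → ChainRing F)) : Prop :=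
  ∃ I : Ideal (QuotRing N lam), K = codeOfIdeal I ∧ I ≠ ⊥ ∧ I ≠ ⊤ ∧
    ∃ a b c, a < q ∧ HasExponents f q I a b c

/-- The ideal `⟨u f^k, u²⟩` of `R[x]/⟨x^N - lam⟩`. -/
def idealII (N : ℕ) (lam : ChainRing F) (f : F[X]) (k : ℕ) : Ideal (QuotRing N lam) :=
  Ideal.span {uQ N lam * incl N lam (f ^ k), uQ N lam ^ 2}

/-- The ideal `⟨f^a + u δ f^{t₁} + u² f^{t₂} D, u f^b + u² δ, u² f^c⟩` of
`R[x]/⟨x^N - lam⟩`, for `δ ∈ F` and `D ∈ F[x]`. -/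
def idealIII (N : ℕ) (lam : ChainRing F) (f : F[X]) (δ : F) (a b c t₁ t₂ : ℕ) (D : F[X]) :
    Ideal (QuotRing N lam) :=
  Ideal.span
    {incl N lam (f ^ a) + uQ N lam * incl N lam (f ^ t₁ * C δ)
        + uQ N lam ^ 2 * incl N lam (f ^ t₂ * D),
      uQ N lam * incl N lam (f ^ b) + uQ N lam ^ 2 * incl N lam (C δ),
      uQ N lam ^ 2 * incl N lam (f ^ c)}

/-- `D` is zero, or `t < c` and `D` is a unit of `R[x]/⟨x^N - lam⟩` of the form
`∑_{l=0}^{c-t-1} Q_l f^l`, where each `Q_l ∈ F[x]` is zero or has degree less than that of `f`. -/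
def IsAdmissible (N : ℕ) (lam : ChainRing F) (f : F[X]) (c t : ℕ) (D : F[X]) : Prop :=
  D = 0 ∨
    (t < c ∧ IsUnit (incl N lam D) ∧
      ∃ Q : ℕ → F[X], (∀ l, Q l ∈ degreeLT F f.natDegree) ∧
        D = ∑ l ∈ Finset.range (c - t), Q l * f ^ l)

end Torsion

end Constacyclic

end

open Polynomial

namespace Constacyclic

/-! ### Duality: the dual code as a reversed annihilator. -/

section Duality

variable {R : Type*} [CommRing R] {N : ℕ} {lam : R}

/-! The coefficient of `x^(N-1)` of a product is a nondegenerate bilinear form on `R[x]/⟨x^N -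
lam⟩`, and it turns the standard pairing into ring multiplication up to reversal of coordinates. So
the dual of the code of `I` is the reversed code of `Ann I` (`mem_dualCode_codeOfIdeal`). If `Ann I
= I`, the code is isodual; conversely, isoduality yields an `R`-linear automorphism carrying `I`
onto `Ann I`.

Write `q = p^s`. Everything rests on the relation `f^q = γ u²` (`incl_pow`) and on `u²` spanning a
copy of `F[x]/⟨f^q⟩`. If `I` has exponents `a, b, c`, then `Ann I` has `Tor_{u²} = ⟨f^(q-a)⟩`, and
comparing cardinalities of sets that an `R`-linear bijection respects gives `c = q - a`. The same
comparison for `Tor_u` gives `b = q - b` (`exponents_of_isIsodual`). Now `2b = p^s` forces `p = 2`,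
excludes `b = q`, and for `a = q` leaves one ideal (`eq_idealII_of_hasExponents`).

Conversely, an ideal of square zero with `a + c = q` and `2b = q` is its own annihilator
(`hasExponents_of_mul_eq_zero`). In characteristic 2 with `δ² = γ`, the element `w = f^(q/2) + uδ`
satisfies `w² = 2γu² + 2uδ f^(q/2) = 0`. The Type III ideals are built from `w`: their generators
are `f^(a-q/2) w + u² f^(t₂) D`, `u w` and `u² f^(q-a)`. -/

lemma root_pow_length : AdjoinRoot.root (X ^ N - C lam : R[X]) ^ N =
    algebraMap R (QuotRing N lam) lam := by
  have h := AdjoinRoot.eval₂_root (X ^ N - C lam : R[X])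
  simp only [eval₂_sub, eval₂_X_pow, eval₂_C] at h
  rw [sub_eq_zero] at h
  exact h

lemma psi_apply (v : Fin N → R) :
    psi N lam v = ∑ i, v i • AdjoinRoot.root (X ^ N - C lam : R[X]) ^ (i : ℕ) := by
  simp [psi, Fintype.linearCombination_apply]

lemma psi_single (i : Fin N) (r : R) :
    psi N lam (Pi.single i r) = r • AdjoinRoot.root (X ^ N - C lam : R[X]) ^ (i : ℕ) := by
  simp [psi]

lemma psi_bijective [Nontrivial R] (hN : N ≠ 0) : Function.Bijective (psi N lam) := by
  have hmon : (X ^ N - C lam : R[X]).Monic := monic_X_pow_sub_C lam hN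
  have hd : (AdjoinRoot.powerBasis' hmon).dim = N := by
    simp [AdjoinRoot.powerBasis'_dim]
  set b := (AdjoinRoot.powerBasis' hmon).basis.reindex (finCongr hd) with hb
  have : (psi N lam : (Fin N → R) → QuotRing N lam) = b.equivFun.symm := by
    funext v
    rw [psi_apply, Module.Basis.equivFun_symm_apply]
    refine Finset.sum_congr rfl fun i _ => ?_
    simp [hb]
  rw [this]
  exact b.equivFun.symm.bijective

/-- The map `psi` as a linear equivalence. -/
noncomputable def psiEquiv [Nontrivial R] (hN : N ≠ 0) (lam : R) :
    (Fin N → R) ≃ₗ[R] QuotRing N lam :=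
  LinearEquiv.ofBijective (psi N lam) (psi_bijective hN)

lemma psiEquiv_apply [Nontrivial R] (hN : N ≠ 0) (v : Fin N → R) :
    psiEquiv hN lam v = psi N lam v := rfl

lemma psi_shift (hN : N ≠ 0) (v : Fin N → R) :
    psi N lam (shift lam v) = AdjoinRoot.root (X ^ N - C lam : R[X]) * psi N lam v := by
  obtain ⟨M, rfl⟩ := Nat.exists_eq_succ_of_ne_zero hN
  rw [psi_apply, psi_apply, Fin.sum_univ_succ, Fin.sum_univ_castSucc, mul_add, Finset.mul_sum,
    add_comm]
  congr 1
  · refine Finset.sum_congr rfl fun i _ => ?_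
    simp only [shift, Fin.val_succ, Nat.succ_ne_zero, if_false, Nat.add_sub_cancel,
      Fin.val_castSucc, mul_smul_comm, pow_succ']
    rfl
  · simp only [shift, Fin.val_zero, if_true, pow_zero, Fin.val_last, mul_smul_comm]
    rw [← pow_succ', root_pow_length, mul_comm, mul_smul, Algebra.algebraMap_eq_smul_one]
    rfl

lemma isConstacyclic_codeOfIdeal (hN : N ≠ 0) (I : Ideal (QuotRing N lam)) :
    IsConstacyclic lam (codeOfIdeal I) := by
  intro v hv
  change psi N lam (shift lam v) ∈ I
  rw [psi_shift hN]
  exact I.mul_mem_left _ hv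

/-- The coefficient of `x^(N-1)` of an element of `R[x]/⟨x^N - lam⟩`. -/
noncomputable def topCoeff [Nontrivial R] (hN : N ≠ 0) (lam : R) : QuotRing N lam →ₗ[R] R :=
  (LinearMap.proj ⟨N - 1, by omega⟩).comp (psiEquiv hN lam).symm.toLinearMap

lemma topCoeff_root_pow [Nontrivial R] (hN : N ≠ 0) {k : ℕ} (hk : k < N) :
    topCoeff hN lam (AdjoinRoot.root (X ^ N - C lam : R[X]) ^ k) =
      if k = N - 1 then 1 else 0 := by
  have h : AdjoinRoot.root (X ^ N - C lam : R[X]) ^ k =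
      psiEquiv hN lam (Pi.single ⟨k, hk⟩ 1) := by
    rw [psiEquiv_apply, psi_single, one_smul]
  rw [topCoeff, LinearMap.comp_apply, h, LinearEquiv.coe_coe, LinearEquiv.symm_apply_apply]
  simp [Pi.single_apply, Fin.ext_iff, eq_comm]

/-- When `i + j ≥ N` the product wraps to `lam x^(i+j-N)` with `i + j - N ≤ N - 2`, so it never
reaches the top coefficient. -/
lemma topCoeff_root_pow_mul [Nontrivial R] (hN : N ≠ 0) (i j : Fin N) :
    topCoeff hN lam (AdjoinRoot.root (X ^ N - C lam : R[X]) ^ (i : ℕ) *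
      AdjoinRoot.root (X ^ N - C lam : R[X]) ^ (j : ℕ)) = if j = i.rev then 1 else 0 := by
  have hi := i.isLt
  have hj := j.isLt
  rw [← pow_add]
  by_cases h : (i : ℕ) + j < N
  · rw [topCoeff_root_pow hN h]
    congr 1
    simp only [Fin.ext_iff, Fin.val_rev, eq_iff_iff]
    omega
  · obtain ⟨k, hk⟩ := Nat.exists_eq_add_of_le (not_lt.mp h)
    rw [hk, pow_add, root_pow_length, ← Algebra.smul_def, map_smul,
      topCoeff_root_pow hN (by omega), if_neg (by omega), if_neg, smul_zero]
    simp only [Fin.ext_iff, Fin.val_rev]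
    omega

lemma topCoeff_psi_mul_psi [Nontrivial R] (hN : N ≠ 0) (v w : Fin N → R) :
    topCoeff hN lam (psi N lam v * psi N lam w) = ∑ i, v i * w i.rev := by
  rw [psi_apply, psi_apply, Finset.sum_mul, map_sum]
  refine Finset.sum_congr rfl fun i _ => ?_
  rw [Finset.mul_sum, map_sum]
  simp only [smul_mul_smul_comm, map_smul, topCoeff_root_pow_mul, smul_eq_mul, mul_ite, mul_one,
    mul_zero, Finset.sum_ite_eq', Finset.mem_univ, if_true]

lemma eq_zero_of_topCoeff_mul [Nontrivial R] (hN : N ≠ 0) (z : QuotRing N lam)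
    (h : ∀ y, topCoeff hN lam (z * y) = 0) : z = 0 := by
  obtain ⟨v, rfl⟩ := (psi_bijective (lam := lam) hN).2 z
  have : v = 0 := by
    funext i
    have := h (psi N lam (Pi.single i.rev 1))
    rw [topCoeff_psi_mul_psi] at this
    simpa [Pi.single_apply] using this
  rw [this, map_zero]

/-- The dual of the code of `I` is the coordinate reversal of the code of the annihilator. -/
lemma mem_dualCode_codeOfIdeal [Nontrivial R] (hN : N ≠ 0) (I : Ideal (QuotRing N lam))
    (v : Fin N → R) :
    v ∈ dualCode (codeOfIdeal I) ↔ psi N lam (v ∘ Fin.rev) ∈ I.annihilator := by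
  have key : ∀ w : Fin N → R,
      topCoeff hN lam (psi N lam (v ∘ Fin.rev) * psi N lam w) = ∑ i, v i * w i := by
    intro w
    rw [topCoeff_psi_mul_psi]
    exact Fintype.sum_equiv Fin.revPerm _ _ fun i => rfl
  rw [Submodule.mem_annihilator]
  constructor
  · intro hv z hz
    -- Since `I` is an ideal, `z * y` is again in `I`; vanishing of the form on all these multiples
    -- upgrades to vanishing of the product.
    refine eq_zero_of_topCoeff_mul hN _ fun y => ?_
    obtain ⟨w, hw⟩ := (psi_bijective (lam := lam) hN).2 (z * y)
    rw [smul_eq_mul, mul_assoc, ← hw, key]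
    exact hv w (show psi N lam w ∈ I from hw ▸ I.mul_mem_right _ hz)
  · intro h w hw
    rw [← key, ← smul_eq_mul, h _ hw, map_zero]

lemma isIsodual_of_eq_annihilator [Nontrivial R] (hN : N ≠ 0) (I : Ideal (QuotRing N lam))
    (h : I.annihilator = I) : IsIsodual (codeOfIdeal I) := by
  refine ⟨Fin.revPerm, fun _ => 1, fun v => ?_⟩
  rw [mem_dualCode_codeOfIdeal hN, h]
  constructor
  · exact fun hv => ⟨v ∘ Fin.rev, hv, fun i => by simp⟩
  · rintro ⟨c, hc, hv⟩
    have : v ∘ Fin.rev = c := by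
      funext i
      simp [hv]
    rw [this]
    exact hc

lemma exists_linearEquiv_of_isIsodual [Nontrivial R] (hN : N ≠ 0) (I : Ideal (QuotRing N lam))
    (h : IsIsodual (codeOfIdeal I)) :
    ∃ E : QuotRing N lam ≃ₗ[R] QuotRing N lam, ∀ z, E z ∈ I.annihilator ↔ z ∈ I := by
  obtain ⟨σ, d, h⟩ := h
  -- The given monomial map followed by the reversal that separates the dual code from the
  -- annihilator.
  let M : (Fin N → R) ≃ₗ[R] (Fin N → R) :=
    (LinearEquiv.funCongrLeft R R σ).trans
      ((LinearEquiv.piCongrRight fun i => LinearEquiv.smulOfUnit (d i)).trans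
        (LinearEquiv.funCongrLeft R R Fin.revPerm))
  have hM : ∀ v, M v ∘ Fin.rev = fun i => (d i : R) * v (σ i) := by
    intro v
    funext i
    simp [M, LinearEquiv.funCongrLeft_apply, LinearMap.funLeft, LinearEquiv.smulOfUnit,
      Units.smul_def]
  refine ⟨(psiEquiv hN lam).symm.trans (M.trans (psiEquiv hN lam)), fun z => ?_⟩
  obtain ⟨v, rfl⟩ := (psiEquiv hN lam).surjective z
  have h1 : psi N lam (M v) ∈ I.annihilator ↔ M v ∘ Fin.rev ∈ dualCode (codeOfIdeal I) := by
    rw [mem_dualCode_codeOfIdeal hN]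
    have : (M v ∘ Fin.rev) ∘ Fin.rev = M v := by
      funext i
      simp
    rw [this]
  rw [LinearEquiv.trans_apply, LinearEquiv.trans_apply, LinearEquiv.symm_apply_apply,
    psiEquiv_apply, psiEquiv_apply, h1, h, hM]
  constructor
  · rintro ⟨c, hc, hv⟩
    have : v = c := by
      funext i
      have := hv (σ.symm i)
      simpa using this
    rw [this]
    exact hc
  · exact fun hv => ⟨v, hv, fun i => rfl⟩

end Duality

end Constacyclic

namespace Constacyclic

/-! ### Coordinates in `F[u]/⟨u³⟩`. -/

section ChainRing

variable (F : Type*) [Field F]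

instance : Nontrivial (ChainRing F) :=
  AdjoinRoot.nontrivial _ (by simp)

lemma u_pow_three : u F ^ 3 = 0 := by
  have h := AdjoinRoot.eval₂_root (X ^ 3 : F[X])
  rwa [eval₂_X_pow] at h

variable {F}

lemma algebraMap_mul_u_sq_eq_zero {r : F}
    (h : algebraMap F (ChainRing F) r * u F ^ 2 = 0) : r = 0 := by
  have h1 : AdjoinRoot.mk (X ^ 3 : F[X]) (C r * X ^ 2) = 0 := by
    rw [map_mul, map_pow]
    exact h
  rw [AdjoinRoot.mk_eq_zero, X_pow_dvd_iff] at h1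
  simpa using h1 2 (by norm_num)

lemma exists_eq_add_u (r : ChainRing F) : ∃ r₀ r₁ r₂ : F,
    r = algebraMap F _ r₀ + u F * algebraMap F _ r₁ + u F ^ 2 * algebraMap F _ r₂ := by
  obtain ⟨P, rfl⟩ := AdjoinRoot.mk_surjective r
  refine ⟨P.coeff 0, P.coeff 1, P.coeff 2, ?_⟩
  have h : AdjoinRoot.mk (X ^ 3 : F[X]) P = AdjoinRoot.mk (X ^ 3 : F[X])
      (C (P.coeff 0) + X * C (P.coeff 1) + X ^ 2 * C (P.coeff 2)) := by
    rw [← sub_eq_zero, ← map_sub, AdjoinRoot.mk_eq_zero, X_pow_dvd_iff]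
    intro d hd
    interval_cases d <;> simp [X_mul_C, X_pow_mul_C, coeff_C]
  rw [h, map_add, map_add, map_mul, map_mul, map_pow]
  rfl

end ChainRing

/-! ### The `u`-layers of the quotient ring, and exponents as divisibility by powers of `f`. -/

section Structure

variable {F : Type*} [Field F]

/-- The hypotheses under which the ideals of `R[x]/⟨x^N - (α + γ u²)⟩` are studied:
`f` is irreducible and `f^q = x^N - α`. -/
structure IsSetting (N : ℕ) (lam : ChainRing F) (f : F[X]) (q : ℕ) (α γ : F) : Prop where
  length_ne_zero : N ≠ 0
  pow_eq : f ^ q = X ^ N - C α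
  lam_eq : lam = unitOf α γ
  gamma_ne_zero : γ ≠ 0
  irreducible : Irreducible f

section Embedding

variable {N : ℕ} {lam : ChainRing F}

lemma uQ_pow_three : uQ N lam ^ 3 = 0 := by
  rw [uQ, ← map_pow, u_pow_three, map_zero]

lemma incl_C (r : F) :
    incl N lam (C r) = algebraMap (ChainRing F) _ (algebraMap F (ChainRing F) r) := by
  rw [incl, aeval_C]
  rfl

lemma incl_eq_psi {a : F[X]} (ha : a ∈ degreeLT F N) :
    incl N lam a = psi N lam fun i => algebraMap F (ChainRing F) (a.coeff i) := by
  rw [psi_apply]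
  have h : a = ∑ i : Fin N, C (a.coeff i) * X ^ (i : ℕ) := by
    rcases eq_or_ne a 0 with rfl | h0
    · simp
    · have hd := (natDegree_lt_iff_degree_lt h0).mpr (mem_degreeLT.mp ha)
      conv_lhs => rw [a.as_sum_range' N hd]
      simp_rw [← C_mul_X_pow_eq_monomial]
      rw [Finset.sum_range]
  conv_lhs => rw [h]
  rw [map_sum]
  refine Finset.sum_congr rfl fun i _ => ?_
  rw [map_mul, incl_C, map_pow, Algebra.smul_def]
  simp [incl]

lemma uQ_mul_psi (v : Fin N → ChainRing F) (k : ℕ) :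
    psi N lam (u F ^ k • v) = uQ N lam ^ k * psi N lam v := by
  rw [map_smul, Algebra.smul_def, map_pow]
  rfl

lemma exists_eq_incl_add (z : QuotRing N lam) (hN : N ≠ 0) :
    ∃ a₀ ∈ degreeLT F N, ∃ a₁ ∈ degreeLT F N, ∃ a₂ ∈ degreeLT F N,
      z = incl N lam a₀ + uQ N lam * incl N lam a₁ + uQ N lam ^ 2 * incl N lam a₂ := by
  obtain ⟨v, rfl⟩ := (psi_bijective (lam := lam) hN).2 z
  choose r₀ r₁ r₂ h using fun i => exists_eq_add_u (v i)
  have key : ∀ r : Fin N → F, ∃ a ∈ degreeLT F N,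
      incl N lam a = psi N lam fun i => algebraMap F (ChainRing F) (r i) := by
    intro r
    refine ⟨((degreeLTEquiv F N).symm r : F[X]), ((degreeLTEquiv F N).symm r).2, ?_⟩
    rw [incl_eq_psi ((degreeLTEquiv F N).symm r).2]
    congr 1
    funext i
    congr 1
    exact congrFun ((degreeLTEquiv F N).apply_symm_apply r) i
  obtain ⟨a₀, h₀, e₀⟩ := key r₀
  obtain ⟨a₁, h₁, e₁⟩ := key r₁
  obtain ⟨a₂, h₂, e₂⟩ := key r₂
  refine ⟨a₀, h₀, a₁, h₁, a₂, h₂, ?_⟩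
  rw [e₀, e₁, e₂, ← uQ_mul_psi, ← pow_one (uQ N lam), ← uQ_mul_psi, ← map_add, ← map_add]
  congr 1
  funext i
  simp [h i]

end Embedding

lemma mk_mem_span {f : F[X]} {i q : ℕ} (hi : i ≤ q) (a : F[X]) :
    AdjoinRoot.mk (f ^ q) a ∈
      (Ideal.span {AdjoinRoot.mk (f ^ q) (f ^ i)} : Ideal (AdjoinRoot (f ^ q))) ↔ f ^ i ∣ a := by
  rw [Ideal.mem_span_singleton]
  constructor
  · rintro ⟨y, hy⟩
    obtain ⟨k, rfl⟩ := AdjoinRoot.mk_surjective y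
    rw [← map_mul, AdjoinRoot.mk_eq_mk] at hy
    have h1 : f ^ i ∣ a - f ^ i * k := (pow_dvd_pow f hi).trans hy
    exact (dvd_sub_left (dvd_mul_right _ _)).mp h1
  · exact fun h => map_dvd _ h

lemma set_eq_span_iff {f : F[X]} {i q : ℕ} (hi : i ≤ q) (T : Set (AdjoinRoot (f ^ q))) :
    T = (Ideal.span {AdjoinRoot.mk (f ^ q) (f ^ i)} : Ideal (AdjoinRoot (f ^ q))) ↔
      ∀ a, AdjoinRoot.mk (f ^ q) a ∈ T ↔ f ^ i ∣ a := by
  rw [Set.ext_iff, (AdjoinRoot.mk_surjective (g := f ^ q)).forall]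
  refine forall_congr' fun a => ?_
  rw [SetLike.mem_coe, mk_mem_span hi]

namespace IsSetting

variable {N : ℕ} {lam : ChainRing F} {f : F[X]} {q : ℕ} {α γ : F}
  (S : IsSetting N lam f q α γ)
include S

lemma monic_pow : (f ^ q).Monic := by
  rw [S.pow_eq]
  exact monic_X_pow_sub_C α S.length_ne_zero

lemma degree_pow : (f ^ q).degree = N := by
  rw [S.pow_eq]
  exact degree_X_pow_sub_C (Nat.pos_of_ne_zero S.length_ne_zero) α

/-- `f^q = x^N - α`, while `x^N = λ = α + γu²` in the quotient. -/
lemma incl_pow : incl N lam f ^ q = incl N lam (C γ) * uQ N lam ^ 2 := by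
  rw [← map_pow, S.pow_eq, map_sub, map_pow]
  have h : incl N lam X = AdjoinRoot.root (X ^ N - C lam : (ChainRing F)[X]) := by simp [incl]
  rw [h, root_pow_length, incl_C, incl_C, uQ, ← map_pow, ← map_mul, ← map_sub]
  congr 1
  rw [S.lam_eq, unitOf]
  ring

lemma uQ_mul_incl_pow : uQ N lam * incl N lam f ^ q = 0 := by
  linear_combination uQ N lam * S.incl_pow + incl N lam (C γ) * uQ_pow_three (lam := lam) (N := N)

lemma uQ_mul_incl_of_dvd {a : F[X]} (h : f ^ q ∣ a) : uQ N lam * incl N lam a = 0 := by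
  obtain ⟨k, rfl⟩ := h
  rw [map_mul, map_pow, ← mul_assoc, S.uQ_mul_incl_pow, zero_mul]

lemma exists_degreeLT (a : F[X]) : ∃ r ∈ degreeLT F N, f ^ q ∣ a - r := by
  refine ⟨a %ₘ f ^ q, ?_, ⟨a /ₘ f ^ q, ?_⟩⟩
  · rw [mem_degreeLT, ← S.degree_pow]
    exact degree_modByMonic_lt _ S.monic_pow
  · linear_combination -modByMonic_add_div a (f ^ q)

/-- The layer `u²` is a faithful copy of `F[x]/⟨f^q⟩`: `u` kills `f^q`, and a remainder of degree
below `N` is determined by its coordinates under `psi`. This converts vanishing of products into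
divisibility. -/
lemma uQ_sq_mul_incl_eq_zero {a : F[X]} :
    uQ N lam ^ 2 * incl N lam a = 0 ↔ f ^ q ∣ a := by
  constructor
  · intro h
    obtain ⟨r, hr, hd⟩ := S.exists_degreeLT a
    have h1 : uQ N lam ^ 2 * incl N lam r = 0 := by
      have := S.uQ_mul_incl_of_dvd hd
      rw [map_sub] at this
      linear_combination h - uQ N lam * this
    rw [incl_eq_psi hr, ← uQ_mul_psi, ← map_zero (psi N lam)] at h1
    have h2 := (psi_bijective S.length_ne_zero).1 h1
    have h3 : r = 0 := by
      ext i
      by_cases hi : i < N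
      · have := congrFun h2 ⟨i, hi⟩
        simp only [Pi.smul_apply, smul_eq_mul, Pi.zero_apply] at this
        rw [mul_comm] at this
        simpa using algebraMap_mul_u_sq_eq_zero this
      · rw [mem_degreeLT] at hr
        rw [coeff_zero]
        exact coeff_eq_zero_of_degree_lt (hr.trans_le (by exact_mod_cast not_lt.mp hi))
    simpa [h3] using hd
  · intro h
    rw [pow_two, mul_assoc, S.uQ_mul_incl_of_dvd h, mul_zero]

lemma pow_dvd_pow_iff {i j : ℕ} : f ^ i ∣ f ^ j ↔ i ≤ j :=
  _root_.pow_dvd_pow_iff S.irreducible.ne_zero S.irreducible.not_isUnit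

lemma pow_dvd_pow_mul {i j k : ℕ} (h : k = i + j) {a : F[X]} : f ^ k ∣ f ^ i * a ↔ f ^ j ∣ a := by
  rw [h, pow_add]
  exact mul_dvd_mul_iff_left (pow_ne_zero _ S.irreducible.ne_zero)

/-- The degree bounds can be dropped: changing the representative by `f^q k` adds `γ u² k`, which is
absorbed in the `u²` coordinate. -/
lemma mk_mem_resU (I : Ideal (QuotRing N lam)) (a : F[X]) :
    AdjoinRoot.mk (f ^ q) a ∈ resU (f ^ q) I ↔
      ∃ a₁ a₂, incl N lam a + uQ N lam * incl N lam a₁ + uQ N lam ^ 2 * incl N lam a₂ ∈ I := by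
  constructor
  · rintro ⟨a₀, -, a₁, -, a₂, -, h, e⟩
    rw [AdjoinRoot.mk_eq_mk] at e
    obtain ⟨k, hk⟩ := e
    refine ⟨a₁, a₂ - C γ * k, ?_⟩
    convert h using 1
    rw [sub_eq_iff_eq_add.mp hk]
    simp only [map_add, map_mul, map_pow, map_sub]
    linear_combination incl N lam k * S.incl_pow
  · rintro ⟨a₁, a₂, h⟩
    obtain ⟨b₀, h₀, k, hk⟩ := S.exists_degreeLT a
    obtain ⟨b₁, h₁, d₁⟩ := S.exists_degreeLT a₁
    obtain ⟨b₂, h₂, d₂⟩ := S.exists_degreeLT (a₂ + C γ * k)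
    refine ⟨b₀, h₀, b₁, h₁, b₂, h₂, ?_, AdjoinRoot.mk_eq_mk.mpr ⟨k, hk⟩⟩
    convert h using 1
    have e₁ := S.uQ_mul_incl_of_dvd d₁
    have e₂ := S.uQ_mul_incl_of_dvd d₂
    rw [sub_eq_iff_eq_add.mp hk]
    simp only [map_add, map_mul, map_pow, map_sub] at e₁ e₂ ⊢
    linear_combination -e₁ - uQ N lam * e₂ - incl N lam k * S.incl_pow

lemma mk_mem_torU (I : Ideal (QuotRing N lam)) (a : F[X]) :
    AdjoinRoot.mk (f ^ q) a ∈ torU (f ^ q) I ↔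
      ∃ a₂, uQ N lam * incl N lam a + uQ N lam ^ 2 * incl N lam a₂ ∈ I := by
  constructor
  · rintro ⟨a₁, -, a₂, -, h, e⟩
    rw [AdjoinRoot.mk_eq_mk] at e
    refine ⟨a₂, ?_⟩
    have e₁ := S.uQ_mul_incl_of_dvd e
    convert h using 1
    rw [map_sub] at e₁
    linear_combination e₁
  · rintro ⟨a₂, h⟩
    obtain ⟨b₁, h₁, d₁⟩ := S.exists_degreeLT a
    obtain ⟨b₂, h₂, d₂⟩ := S.exists_degreeLT a₂
    refine ⟨b₁, h₁, b₂, h₂, ?_, AdjoinRoot.mk_eq_mk.mpr d₁⟩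
    have e₁ := S.uQ_mul_incl_of_dvd d₁
    have e₂ := S.uQ_mul_incl_of_dvd d₂
    convert h using 1
    rw [map_sub] at e₁ e₂
    linear_combination -e₁ - uQ N lam * e₂

lemma mk_mem_torU2 (I : Ideal (QuotRing N lam)) (a : F[X]) :
    AdjoinRoot.mk (f ^ q) a ∈ torU2 (f ^ q) I ↔ uQ N lam ^ 2 * incl N lam a ∈ I := by
  constructor
  · rintro ⟨a₂, -, h, e⟩
    rw [AdjoinRoot.mk_eq_mk] at e
    have e₁ := S.uQ_mul_incl_of_dvd e
    convert h using 1
    rw [map_sub] at e₁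
    linear_combination uQ N lam * e₁
  · intro h
    obtain ⟨b₂, h₂, d₂⟩ := S.exists_degreeLT a
    refine ⟨b₂, h₂, ?_, AdjoinRoot.mk_eq_mk.mpr d₂⟩
    have e₂ := S.uQ_mul_incl_of_dvd d₂
    convert h using 1
    rw [map_sub] at e₂
    linear_combination -uQ N lam * e₂

lemma hasExponents_iff (I : Ideal (QuotRing N lam)) (a b c : ℕ) :
    HasExponents f q I a b c ↔ c ≤ b ∧ b ≤ a ∧ a ≤ q ∧
      (∀ z, (∃ a₁ a₂, incl N lam z + uQ N lam * incl N lam a₁ +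
        uQ N lam ^ 2 * incl N lam a₂ ∈ I) ↔ f ^ a ∣ z) ∧
      (∀ z, (∃ a₂, uQ N lam * incl N lam z + uQ N lam ^ 2 * incl N lam a₂ ∈ I) ↔ f ^ b ∣ z) ∧
      (∀ z, uQ N lam ^ 2 * incl N lam z ∈ I ↔ f ^ c ∣ z) := by
  refine and_congr_right fun h₁ => and_congr_right fun h₂ => and_congr_right fun h₃ => ?_
  rw [set_eq_span_iff h₃, set_eq_span_iff (h₂.trans h₃),
    set_eq_span_iff (h₁.trans (h₂.trans h₃))]
  simp only [S.mk_mem_resU, S.mk_mem_torU, S.mk_mem_torU2]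

end IsSetting

end Structure

end Constacyclic

/-! ### Ideals of square zero that equal their annihilator. -/

namespace Constacyclic

namespace IsSetting

variable {F : Type*} [Field F] {N : ℕ} {lam : ChainRing F} {f : F[X]} {q : ℕ} {α γ : F}
  (S : IsSetting N lam f q α γ)
include S

lemma dvd_of_mul_uQ_sq_eq_zero {z₀ z₁ z₂ w : F[X]}
    (h : (incl N lam z₀ + uQ N lam * incl N lam z₁ + uQ N lam ^ 2 * incl N lam z₂) *
      (uQ N lam ^ 2 * incl N lam w) = 0) : f ^ q ∣ w * z₀ := by
  rw [← S.uQ_sq_mul_incl_eq_zero, map_mul]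
  linear_combination h - (incl N lam z₁ * incl N lam w +
    uQ N lam * incl N lam z₂ * incl N lam w) * uQ_pow_three (N := N) (lam := lam)

lemma dvd_of_mul_uQ_eq_zero {z₁ z₂ w₁ w₂ : F[X]}
    (h : (uQ N lam * incl N lam z₁ + uQ N lam ^ 2 * incl N lam z₂) *
      (uQ N lam * incl N lam w₁ + uQ N lam ^ 2 * incl N lam w₂) = 0) : f ^ q ∣ w₁ * z₁ := by
  rw [← S.uQ_sq_mul_incl_eq_zero, map_mul]
  linear_combination h - (incl N lam z₁ * incl N lam w₂ + incl N lam z₂ * incl N lam w₁ +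
    uQ N lam * incl N lam z₂ * incl N lam w₂) * uQ_pow_three (N := N) (lam := lam)

variable {I : Ideal (QuotRing N lam)} {a b c : ℕ} {g₁ g₂ h₂ : F[X]}

/-- An ideal of square zero with large enough residue and torsion ideals is its own annihilator,
and its exponents are determined. -/
lemma hasExponents_of_mul_eq_zero (hI : ∀ x ∈ I, ∀ y ∈ I, x * y = 0)
    (hcb : c ≤ b) (hba : b ≤ a) (hac : a + c = q) (hb : 2 * b = q)
    (G₁ : incl N lam (f ^ a) + uQ N lam * incl N lam g₁ + uQ N lam ^ 2 * incl N lam g₂ ∈ I)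
    (G₂ : uQ N lam * incl N lam (f ^ b) + uQ N lam ^ 2 * incl N lam h₂ ∈ I)
    (G₃ : uQ N lam ^ 2 * incl N lam (f ^ c) ∈ I) :
    HasExponents f q I a b c ∧ I.annihilator = I := by
  -- Each layer of the annihilator is tested against the generator that leaves only a `u²` term:
  -- residues against `G₃`, the `u` layer against `G₂`, the `u²` layer against `G₁`. The relations
  -- `a + c = q` and `2b = q` return the exponents of `I` itself.
  have A : ∀ z₀ z₁ z₂, incl N lam z₀ + uQ N lam * incl N lam z₁ + uQ N lam ^ 2 * incl N lam z₂ ∈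
      I.annihilator → f ^ a ∣ z₀ := fun z₀ z₁ z₂ h =>
    (S.pow_dvd_pow_mul (by omega)).mp
      (S.dvd_of_mul_uQ_sq_eq_zero (Submodule.mem_annihilator.mp h _ G₃))
  have B : ∀ z₁ z₂, uQ N lam * incl N lam z₁ + uQ N lam ^ 2 * incl N lam z₂ ∈
      I.annihilator → f ^ b ∣ z₁ := fun z₁ z₂ h =>
    (S.pow_dvd_pow_mul (by omega)).mp
      (S.dvd_of_mul_uQ_eq_zero (Submodule.mem_annihilator.mp h _ G₂))
  have Cc : ∀ z₂, uQ N lam ^ 2 * incl N lam z₂ ∈ I.annihilator → f ^ c ∣ z₂ := fun z₂ h => by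
    have := Submodule.mem_annihilator.mp h _ G₁
    rw [smul_eq_mul, mul_comm] at this
    have := S.dvd_of_mul_uQ_sq_eq_zero this
    rw [mul_comm] at this
    exact (S.pow_dvd_pow_mul (by omega)).mp this
  have hle : I ≤ I.annihilator := fun x hx => Submodule.mem_annihilator.mpr fun y hy => hI x hx y hy
  refine ⟨(S.hasExponents_iff I a b c).mpr ⟨hcb, hba, by omega, fun z => ⟨?_, ?_⟩,
    fun z => ⟨?_, ?_⟩, fun z => ⟨fun h => Cc z (hle h), ?_⟩⟩, le_antisymm ?_ hle⟩
  · rintro ⟨a₁, a₂, h⟩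
    exact A _ _ _ (hle h)
  · rintro ⟨k, rfl⟩
    refine ⟨g₁ * k, g₂ * k, ?_⟩
    convert I.mul_mem_right (incl N lam k) G₁ using 1
    simp only [map_mul]
    ring
  · rintro ⟨a₂, h⟩
    exact B _ _ (hle h)
  · rintro ⟨k, rfl⟩
    refine ⟨h₂ * k, ?_⟩
    convert I.mul_mem_right (incl N lam k) G₂ using 1
    simp only [map_mul]
    ring
  · rintro ⟨k, rfl⟩
    convert I.mul_mem_right (incl N lam k) G₃ using 1
    simp only [map_mul]
    ring
  -- An annihilating element is peeled layer by layer: subtracting multiples of `G₁`, then `G₂`,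
  -- stays in the annihilator because `I ≤ I.annihilator`, so the next divisibility applies.
  · intro z hz
    obtain ⟨z₀, -, z₁, -, z₂, -, rfl⟩ := exists_eq_incl_add z S.length_ne_zero
    obtain ⟨k₀, rfl⟩ := A _ _ _ hz
    have m₀ := I.mul_mem_right (incl N lam k₀) G₁
    have hz' : uQ N lam * incl N lam (z₁ - g₁ * k₀) + uQ N lam ^ 2 * incl N lam (z₂ - g₂ * k₀) ∈
        I.annihilator := by
      convert sub_mem hz (hle m₀) using 1
      simp only [map_mul, map_sub]
      ring
    obtain ⟨k₁, e₁⟩ := B _ _ hz'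
    have m₁ := I.mul_mem_right (incl N lam k₁) G₂
    have hz'' : uQ N lam ^ 2 * incl N lam (z₂ - g₂ * k₀ - h₂ * k₁) ∈ I.annihilator := by
      convert sub_mem hz' (hle m₁) using 1
      rw [e₁]
      simp only [map_mul, map_sub]
      ring
    obtain ⟨k₂, e₂⟩ := Cc _ hz''
    have m₂ := I.mul_mem_right (incl N lam k₂) G₃
    convert add_mem (add_mem m₀ m₁) m₂ using 1
    rw [sub_eq_iff_eq_add.mp e₁, sub_eq_iff_eq_add.mp (sub_eq_iff_eq_add.mp e₂)]
    simp only [map_mul, map_add]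
    ring

lemma ne_bot_of_hasExponents (h : HasExponents f q I a b c) (hc : c < q) : I ≠ ⊥ := by
  rintro rfl
  have := ((S.hasExponents_iff _ _ _ _).mp h).2.2.2.2.2 (f ^ c)
  rw [Ideal.mem_bot, S.uQ_sq_mul_incl_eq_zero, S.pow_dvd_pow_iff] at this
  have := this.mpr dvd_rfl
  omega

lemma ne_top_of_mul_eq_zero (hq : q ≠ 0) (hI : ∀ x ∈ I, ∀ y ∈ I, x * y = 0) : I ≠ ⊤ := by
  rintro rfl
  have h := hI 1 trivial _ (Submodule.mem_top (x := uQ N lam ^ 2 * incl N lam 1))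
  rw [one_mul, S.uQ_sq_mul_incl_eq_zero] at h
  have h := (S.pow_dvd_pow_iff (i := q) (j := 0)).mp (by simpa using h)
  omega

end IsSetting

end Constacyclic

/-! ### Isoduality determines the exponents. -/

namespace Constacyclic

/-- The set of the elements `u² w` of `R[x]/⟨x^N - lam⟩` with `f^i ∣ w`. -/
def socle {F : Type*} [Field F] (N : ℕ) (lam : ChainRing F) (f : F[X]) (i : ℕ) :
    Set (QuotRing N lam) :=
  {z | ∃ w, f ^ i ∣ w ∧ z = uQ N lam ^ 2 * incl N lam w}

namespace IsSetting

variable {F : Type*} [Field F] {N : ℕ} {lam : ChainRing F} {f : F[X]} {q : ℕ} {α γ : F}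
  (S : IsSetting N lam f q α γ)
include S

/-- Both lower coordinates must be divisible by `f^q`; the residue then becomes a multiple of `γu²`
and the `u` term vanishes. -/
lemma exists_of_uQ_mul_eq_zero {z : QuotRing N lam} (h : uQ N lam * z = 0) :
    ∃ w, z = uQ N lam ^ 2 * incl N lam w := by
  obtain ⟨z₀, -, z₁, -, z₂, -, rfl⟩ := exists_eq_incl_add z S.length_ne_zero
  have u3 := uQ_pow_three (N := N) (lam := lam)
  obtain ⟨k, rfl⟩ := S.uQ_sq_mul_incl_eq_zero.mp (show uQ N lam ^ 2 * incl N lam z₀ = 0 by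
    linear_combination uQ N lam * h - (incl N lam z₁ + uQ N lam * incl N lam z₂) * u3)
  have h₀ := S.uQ_mul_incl_of_dvd (dvd_mul_right (f ^ q) k)
  have h₁ := S.uQ_mul_incl_of_dvd (S.uQ_sq_mul_incl_eq_zero.mp
    (show uQ N lam ^ 2 * incl N lam z₁ = 0 by
      linear_combination h - h₀ - incl N lam z₂ * u3))
  refine ⟨C γ * k + z₂, ?_⟩
  rw [h₁]
  simp only [map_mul, map_add, map_pow]
  linear_combination incl N lam k * S.incl_pow

lemma exists_of_uQ_sq_mul_eq_zero {z : QuotRing N lam} (h : uQ N lam ^ 2 * z = 0) :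
    ∃ z₁ z₂, z = uQ N lam * incl N lam z₁ + uQ N lam ^ 2 * incl N lam z₂ := by
  obtain ⟨z₀, -, z₁, -, z₂, -, rfl⟩ := exists_eq_incl_add z S.length_ne_zero
  have u3 := uQ_pow_three (N := N) (lam := lam)
  obtain ⟨k, rfl⟩ := S.uQ_sq_mul_incl_eq_zero.mp (show uQ N lam ^ 2 * incl N lam z₀ = 0 by
    linear_combination h - (incl N lam z₁ + uQ N lam * incl N lam z₂) * u3)
  refine ⟨z₁, C γ * k + z₂, ?_⟩
  simp only [map_mul, map_add, map_pow]
  linear_combination incl N lam k * S.incl_pow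

lemma setOf_uQ_mul_eq_zero {J : Ideal (QuotRing N lam)} {c : ℕ}
    (h : ∀ z, uQ N lam ^ 2 * incl N lam z ∈ J ↔ f ^ c ∣ z) :
    {z | z ∈ J ∧ uQ N lam * z = 0} = socle N lam f c := by
  ext z
  constructor
  · rintro ⟨hz, hu⟩
    obtain ⟨w, rfl⟩ := S.exists_of_uQ_mul_eq_zero hu
    exact ⟨w, (h w).mp hz, rfl⟩
  · rintro ⟨w, hw, rfl⟩
    exact ⟨(h w).mpr hw, by linear_combination incl N lam w * uQ_pow_three (N := N) (lam := lam)⟩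

/-- Moves `Tor_u` into the `u²` layer by a description that uses only `J` and multiplication by `u`,
hence is transported by `R`-linear bijections. -/
lemma setOf_exists_uQ_mul {J : Ideal (QuotRing N lam)} :
    {z | ∃ y ∈ J, uQ N lam ^ 2 * y = 0 ∧ z = uQ N lam * y} =
      {z | ∃ w, (∃ a₂, uQ N lam * incl N lam w + uQ N lam ^ 2 * incl N lam a₂ ∈ J) ∧
        z = uQ N lam ^ 2 * incl N lam w} := by
  have u3 := uQ_pow_three (N := N) (lam := lam)
  ext z
  constructor
  · rintro ⟨y, hy, hu, rfl⟩
    obtain ⟨z₁, z₂, rfl⟩ := S.exists_of_uQ_sq_mul_eq_zero hu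
    exact ⟨z₁, ⟨z₂, hy⟩, by linear_combination incl N lam z₂ * u3⟩
  · rintro ⟨w, ⟨a₂, h⟩, rfl⟩
    exact ⟨_, h, by linear_combination (incl N lam w + uQ N lam * incl N lam a₂) * u3,
      by linear_combination -incl N lam a₂ * u3⟩

lemma socle_subset_socle_iff {i j : ℕ} (hi : i ≤ q) :
    socle N lam f j ⊆ socle N lam f i ↔ i ≤ j := by
  constructor
  · intro h
    obtain ⟨w, hw, e⟩ := h ⟨f ^ j, dvd_rfl, rfl⟩
    rw [← sub_eq_zero, ← mul_sub, ← map_sub, S.uQ_sq_mul_incl_eq_zero] at e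
    rw [← S.pow_dvd_pow_iff]
    exact (dvd_sub_left hw).mp ((pow_dvd_pow f hi).trans e)
  · rintro h _ ⟨w, hw, rfl⟩
    exact ⟨w, (pow_dvd_pow f h).trans hw, rfl⟩

lemma finite_quotRing [Finite F] : Finite (QuotRing N lam) := by
  have : Module.Finite F (ChainRing F) := (monic_X_pow 3).finite_adjoinRoot
  have : Finite (ChainRing F) := Module.finite_of_finite F
  exact Finite.of_surjective _ (psi_bijective (lam := lam) S.length_ne_zero).2

/-- These finite sets form a strictly decreasing chain for exponents up to `q`, so cardinality
recovers the exponent. -/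
lemma le_of_ncard_socle_le [Finite F] {i j : ℕ} (hi : i ≤ q) (hj : j ≤ q)
    (h : (socle N lam f i).ncard ≤ (socle N lam f j).ncard) : j ≤ i := by
  have := S.finite_quotRing
  by_contra! hlt
  have hs := (S.socle_subset_socle_iff hi).mpr hlt.le
  have := Set.eq_of_subset_of_ncard_le hs h
  have := (S.socle_subset_socle_iff hj).mp this.ge
  omega

/-- The exponents of an ideal whose code is isodual. -/
lemma exponents_of_isIsodual [Finite F] {I : Ideal (QuotRing N lam)} {a b c : ℕ}
    (hexp : HasExponents f q I a b c) (h : IsIsodual (codeOfIdeal I)) :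
    a + c = q ∧ 2 * b = q := by
  obtain ⟨hcb, hba, haq, hA, hB, hC⟩ := (S.hasExponents_iff _ _ _ _).mp hexp
  have u3 := uQ_pow_three (N := N) (lam := lam)
  obtain ⟨g₁, g₂, G₁⟩ := (hA (f ^ a)).mpr dvd_rfl
  obtain ⟨h₂, G₂⟩ := (hB (f ^ b)).mpr dvd_rfl
  obtain ⟨E, hE⟩ := exists_linearEquiv_of_isIsodual S.length_ne_zero I h
  have hEu : ∀ z, E (uQ N lam * z) = uQ N lam * E z := fun z => by
    rw [uQ, ← Algebra.smul_def, map_smul, Algebra.smul_def]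
  have hEu2 : ∀ z, E (uQ N lam ^ 2 * z) = uQ N lam ^ 2 * E z := fun z => by
    rw [pow_two, mul_assoc, mul_assoc, hEu, hEu]
  -- Multiplication by `u² z` sees only the residue of an element of `I`, and these residues are the
  -- multiples of `f^a`.
  have hC' : ∀ z, uQ N lam ^ 2 * incl N lam z ∈ I.annihilator ↔ f ^ (q - a) ∣ z := by
    intro z
    constructor
    · intro hz
      have := Submodule.mem_annihilator.mp hz _ G₁
      rw [smul_eq_mul, mul_comm] at this
      have := S.dvd_of_mul_uQ_sq_eq_zero this
      rw [mul_comm] at this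
      exact (S.pow_dvd_pow_mul (by omega)).mp this
    · rintro hz
      refine Submodule.mem_annihilator.mpr fun y hy => ?_
      obtain ⟨y₀, -, y₁, -, y₂, -, rfl⟩ := exists_eq_incl_add y S.length_ne_zero
      have hy₀ := (hA y₀).mp ⟨_, _, hy⟩
      have : f ^ q ∣ z * y₀ := by
        rw [show q = (q - a) + a by omega, pow_add]
        exact mul_dvd_mul hz hy₀
      have := S.uQ_sq_mul_incl_eq_zero.mpr this
      rw [map_mul] at this
      rw [smul_eq_mul]
      linear_combination this + (incl N lam z * incl N lam y₁ +
        uQ N lam * incl N lam z * incl N lam y₂) * u3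
  have hcard₂ : (socle N lam f c).ncard = (socle N lam f (q - a)).ncard := by
    rw [← S.setOf_uQ_mul_eq_zero hC, ← S.setOf_uQ_mul_eq_zero hC',
      ← Set.ncard_image_of_injective _ E.injective]
    congr 1
    ext z
    constructor
    · rintro ⟨y, ⟨hy, hu⟩, rfl⟩
      exact ⟨(hE y).mpr hy, by rw [← hEu, hu, map_zero]⟩
    · rintro ⟨hz, hu⟩
      obtain ⟨y, rfl⟩ := E.surjective z
      rw [← hEu, map_eq_zero_iff _ E.injective] at hu
      exact ⟨y, ⟨(hE y).mp hz, hu⟩, rfl⟩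
  have hac : c = q - a := le_antisymm
    (S.le_of_ncard_socle_le (by omega) (by omega) hcard₂.ge) (S.le_of_ncard_socle_le (by omega) (by omega) hcard₂.le)
  have hsocI : {z | ∃ y ∈ I, uQ N lam ^ 2 * y = 0 ∧ z = uQ N lam * y} = socle N lam f b := by
    rw [S.setOf_exists_uQ_mul]
    simp only [hB]
    rfl
  have hcard₁ : (socle N lam f b).ncard =
      {z | ∃ y ∈ I.annihilator, uQ N lam ^ 2 * y = 0 ∧ z = uQ N lam * y}.ncard := by
    rw [← hsocI, ← Set.ncard_image_of_injective _ E.injective]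
    congr 1
    ext z
    constructor
    · rintro ⟨_, ⟨y, hy, hu, rfl⟩, rfl⟩
      exact ⟨E y, (hE y).mpr hy, by rw [← hEu2, hu, map_zero], hEu y⟩
    · rintro ⟨z, hz, hu, rfl⟩
      obtain ⟨y, rfl⟩ := E.surjective z
      rw [← hEu2, map_eq_zero_iff _ E.injective] at hu
      exact ⟨_, ⟨y, (hE y).mp hz, hu, rfl⟩, hEu y⟩
  rw [S.setOf_exists_uQ_mul] at hcard₁
  have hB' : ∀ z, (∃ a₂, uQ N lam * incl N lam z + uQ N lam ^ 2 * incl N lam a₂ ∈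
      I.annihilator) → f ^ (q - b) ∣ z := by
    rintro z ⟨a₂, hz⟩
    exact (S.pow_dvd_pow_mul (by omega)).mp
      (S.dvd_of_mul_uQ_eq_zero (Submodule.mem_annihilator.mp hz _ G₂))
  have := S.finite_quotRing
  -- The easy inclusion for `Tor_u` of the annihilator already gives `q ≤ 2b ≤ a + b`, so the
  -- subtraction in `a + b - q` below is not truncated.
  have hqb : q - b ≤ b := by
    refine S.le_of_ncard_socle_le (by omega) (by omega) (hcard₁.le.trans (Set.ncard_le_ncard ?_))
    rintro _ ⟨w, hw, rfl⟩
    exact ⟨w, hB' w hw, rfl⟩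
  have hB'' : ∀ z, (∃ a₂, uQ N lam * incl N lam z + uQ N lam ^ 2 * incl N lam a₂ ∈
      I.annihilator) ↔ f ^ (q - b) ∣ z := by
    refine fun z => ⟨hB' z, ?_⟩
    rintro ⟨m, rfl⟩
    -- Multiplying `G₁` by `f^(q-a)` turns its leading term into `f^q = γu²`, which leaves an
    -- element of `I` with no residue.
    obtain ⟨k, hk⟩ : f ^ b ∣ f ^ (q - a) * g₁ := by
      refine (hB _).mp ⟨C γ + f ^ (q - a) * g₂, ?_⟩
      convert I.mul_mem_left (incl N lam (f ^ (q - a))) G₁ using 1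
      have := S.incl_pow
      rw [show q = (q - a) + a by omega, pow_add] at this
      simp only [map_mul, map_add, map_pow]
      linear_combination -this
    obtain rfl : g₁ = f ^ (a + b - q) * k := by
      refine mul_left_cancel₀ (pow_ne_zero (q - a) S.irreducible.ne_zero) ?_
      rw [hk, ← mul_assoc, ← pow_add]
      congr 2
      omega
    -- For `y ∈ I` with residue `f^a l`, subtracting `l G₁` gives `y₁ ≡ f^(a+b-q) k l` modulo `f^b`.
    -- So `f^(q-b) y₁ ≡ f^a k l` modulo `f^q`, which the correction `-u² k` cancels.
    have hT : uQ N lam * incl N lam (f ^ (q - b)) - uQ N lam ^ 2 * incl N lam k ∈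
        I.annihilator := by
      refine Submodule.mem_annihilator.mpr fun y hy => ?_
      obtain ⟨y₀, -, y₁, -, y₂, -, rfl⟩ := exists_eq_incl_add y S.length_ne_zero
      obtain ⟨l, rfl⟩ := (hA y₀).mp ⟨_, _, hy⟩
      have hd : f ^ b ∣ y₁ - f ^ (a + b - q) * k * l := by
        refine (hB _).mp ⟨y₂ - g₂ * l, ?_⟩
        convert sub_mem hy (I.mul_mem_right (incl N lam l) G₁) using 1
        simp only [map_mul, map_sub]
        ring
      have e₁ : uQ N lam ^ 2 *
          incl N lam (f ^ (q - b) * (y₁ - f ^ (a + b - q) * k * l)) = 0 := by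
        rw [S.uQ_sq_mul_incl_eq_zero]
        conv_lhs => rw [show q = (q - b) + b by omega, pow_add]
        exact mul_dvd_mul_left _ hd
      have e₂ : uQ N lam * incl N lam (f ^ (q - b) * f ^ a) = 0 := by
        refine S.uQ_mul_incl_of_dvd ?_
        rw [← pow_add]
        exact pow_dvd_pow f (by omega)
      have e₃ : incl N lam (f ^ a) = incl N lam (f ^ (q - b)) * incl N lam (f ^ (a + b - q)) := by
        rw [← map_mul, ← pow_add]
        congr 2
        omega
      simp only [map_mul, map_sub] at e₁ e₂ ⊢
      rw [smul_eq_mul]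
      linear_combination e₁ + incl N lam l * e₂ -
        uQ N lam ^ 2 * incl N lam k * incl N lam l * e₃ +
        (incl N lam (f ^ (q - b)) * incl N lam y₂ - incl N lam k * incl N lam y₁ -
          uQ N lam * incl N lam k * incl N lam y₂) * u3
    refine ⟨-k * m, ?_⟩
    convert I.annihilator.mul_mem_right (incl N lam m) hT using 1
    simp only [map_mul, map_neg]
    ring
  simp only [hB''] at hcard₁
  have := S.le_of_ncard_socle_le (i := q - b) (j := b) (by omega) (by omega) hcard₁.ge
  omega

end IsSetting

end Constacyclic

/-! ### The explicit ideals of Types II and III. -/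

namespace Constacyclic

lemma mul_eq_zero_of_mem_span {A : Type*} [CommRing A] {s : Set A}
    (h : ∀ x ∈ s, ∀ y ∈ s, x * y = 0) :
    ∀ x ∈ Ideal.span s, ∀ y ∈ Ideal.span s, x * y = 0 := by
  intro x hx y hy
  have := Ideal.mul_mem_mul hx hy
  rw [Ideal.span_mul_span'] at this
  refine (Ideal.span_eq_bot.mpr ?_).le this
  rintro _ ⟨x, hx, y, hy, rfl⟩
  exact h x hx y hy

lemma two_eq_zero {F : Type*} [Field F] [CharP F 2] (N : ℕ) (lam : ChainRing F) :
    (2 : QuotRing N lam) = 0 := by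
  rw [← map_ofNat (incl N lam) 2, show (OfNat.ofNat 2 : F[X]) = 0 from CharTwo.two_eq_zero,
    map_zero]

namespace IsSetting

variable {F : Type*} [Field F] {N : ℕ} {lam : ChainRing F} {f : F[X]} {q : ℕ} {α γ : F}
  (S : IsSetting N lam f q α γ)
include S

lemma idealII_mul_eq_zero {k : ℕ} (hk : 2 * k = q) :
    ∀ x ∈ idealII N lam f k, ∀ y ∈ idealII N lam f k, x * y = 0 := by
  have u3 := uQ_pow_three (N := N) (lam := lam)
  have h := S.incl_pow
  rw [← hk, two_mul, pow_add] at h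
  refine mul_eq_zero_of_mem_span ?_
  simp only [Set.mem_insert_iff, Set.mem_singleton_iff, map_pow]
  rintro x (rfl | rfl) y (rfl | rfl)
  · linear_combination uQ N lam ^ 2 * h + incl N lam (C γ) * uQ N lam * u3
  · linear_combination incl N lam f ^ k * u3
  · linear_combination incl N lam f ^ k * u3
  · linear_combination uQ N lam * u3

lemma idealII_spec {k : ℕ} (hk : 2 * k = q) :
    HasExponents f q (idealII N lam f k) q k 0 ∧
      (idealII N lam f k).annihilator = idealII N lam f k := by
  -- For `a = q` the first generator may be taken to be `f^q - γu²`, which is zero; hence `g₂ = -C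
  -- γ`.
  refine S.hasExponents_of_mul_eq_zero (g₁ := 0) (g₂ := -C γ) (h₂ := 0)
    (S.idealII_mul_eq_zero hk) (by omega) (by omega) (by omega) hk ?_ ?_ ?_
  · convert zero_mem (idealII N lam f k) using 1
    simp only [map_pow, map_neg, map_zero]
    linear_combination S.incl_pow
  · rw [map_zero, mul_zero, add_zero]
    exact Ideal.subset_span (Set.mem_insert _ _)
  · rw [pow_zero, map_one, mul_one]
    exact Ideal.subset_span (Set.mem_insert_of_mem _ (Set.mem_singleton _))

/-- With `c = 0` the ideal contains `u²`, which absorbs both the residues `f^q l = γu² l` and every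
correction to `u f^k`. -/
lemma eq_idealII_of_hasExponents {I : Ideal (QuotRing N lam)} {k : ℕ}
    (h : HasExponents f q I q k 0) : I = idealII N lam f k := by
  obtain ⟨-, -, -, hA, hB, hC⟩ := (S.hasExponents_iff _ _ _ _).mp h
  have hu : uQ N lam ^ 2 ∈ I := by simpa using (hC 1).mpr (by simp)
  have huII : uQ N lam ^ 2 ∈ idealII N lam f k :=
    Ideal.subset_span (Set.mem_insert_of_mem _ (Set.mem_singleton _))
  refine le_antisymm (fun z hz => ?_) (Ideal.span_le.mpr ?_)
  · obtain ⟨z₀, -, z₁, -, z₂, -, rfl⟩ := exists_eq_incl_add z S.length_ne_zero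
    obtain ⟨l, rfl⟩ := (hA z₀).mp ⟨_, _, hz⟩
    have e : incl N lam (f ^ q * l) = uQ N lam ^ 2 * incl N lam (C γ * l) := by
      rw [map_mul, map_mul, map_pow, S.incl_pow]
      ring
    rw [e] at hz ⊢
    obtain ⟨l₁, rfl⟩ := (hB z₁).mp ⟨C γ * l + z₂, by
      convert hz using 1
      rw [map_add]
      ring⟩
    refine add_mem (add_mem (Ideal.mul_mem_right _ _ huII) ?_) (Ideal.mul_mem_right _ _ huII)
    rw [map_mul, ← mul_assoc]
    exact Ideal.mul_mem_right _ _ (Ideal.subset_span (Set.mem_insert _ _))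
  · rintro x (rfl | rfl)
    · obtain ⟨a₂, h⟩ := (hB (f ^ k)).mpr dvd_rfl
      exact (I.add_mem_iff_left (I.mul_mem_right _ hu)).mp h
    · exact hu

variable [CharP F 2]

lemma idealIII_mul_eq_zero {h a t₂ : ℕ} {δ : F} {D : F[X]} (hh : 2 * h = q) (hδ : δ ^ 2 = γ)
    (ha : h ≤ a) (haq : a ≤ q) :
    ∀ x ∈ idealIII N lam f δ a h (q - a) (a - h) t₂ D,
      ∀ y ∈ idealIII N lam f δ a h (q - a) (a - h) t₂ D, x * y = 0 := by
  have u3 := uQ_pow_three (N := N) (lam := lam)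
  have two := two_eq_zero N lam
  obtain ⟨r, rfl⟩ := Nat.exists_eq_add_of_le ha
  obtain ⟨c, hc⟩ := Nat.exists_eq_add_of_le haq
  rw [show q - (h + r) = c by omega, Nat.add_sub_cancel_left]
  have hq := S.incl_pow
  rw [← hh, two_mul, pow_add, ← hδ, C_pow, map_pow] at hq
  -- From `2h = q = h + r + c` one gets `h = r + c`, so the first generator times `u² f^c` has
  -- leading term `u² f^(2h) = 0`.
  have hrc : incl N lam f ^ h = incl N lam f ^ r * incl N lam f ^ c := by
    rw [← pow_add]
    congr 1
    omega
  refine mul_eq_zero_of_mem_span ?_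
  simp only [Set.mem_insert_iff, Set.mem_singleton_iff, map_pow, map_mul, pow_add]
  generalize incl N lam f ^ h = H at *
  generalize incl N lam f ^ r = R at *
  generalize incl N lam f ^ c = K at *
  generalize incl N lam f ^ t₂ * incl N lam D = D at *
  generalize incl N lam (C δ) = d at *
  generalize uQ N lam = U at *
  -- `H² = γu² = U² d²`, so the square is a multiple of 2. The first two generators are `R w + U² D`
  -- and `U w` with `w = H + U d`.
  have hw : (H + U * d) ^ 2 = 0 := by
    linear_combination hq + (H * U * d + U ^ 2 * d ^ 2) * two
  have hUH : U * H ^ 2 = 0 := by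
    linear_combination U * hq + d ^ 2 * u3
  have e₁₂ : (H * R + U * (R * d) + U ^ 2 * D) * (U * H + U ^ 2 * d) = 0 := by
    linear_combination U * R * hw + D * (H + U * d) * u3
  have e₁₃ : (H * R + U * (R * d) + U ^ 2 * D) * (U ^ 2 * K) = 0 := by
    linear_combination U * hUH - U ^ 2 * H * hrc + (R * d * K + U * D * K) * u3
  have e₂₃ : (U * H + U ^ 2 * d) * (U ^ 2 * K) = 0 := by
    linear_combination (H * K + U * d * K) * u3
  rintro x (rfl | rfl | rfl) y (rfl | rfl | rfl)
  · linear_combination R ^ 2 * hw + R * (H + U * d) * U ^ 2 * D * two + U * D ^ 2 * u3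
  · exact e₁₂
  · exact e₁₃
  · exact mul_comm _ _ |>.trans e₁₂
  · linear_combination U ^ 2 * hw
  · exact e₂₃
  · exact mul_comm _ _ |>.trans e₁₃
  · exact mul_comm _ _ |>.trans e₂₃
  · linear_combination U * K ^ 2 * u3

lemma idealIII_spec {h a t₂ : ℕ} {δ : F} {D : F[X]} (hh : 2 * h = q) (hδ : δ ^ 2 = γ)
    (ha : h ≤ a) (haq : a ≤ q) :
    HasExponents f q (idealIII N lam f δ a h (q - a) (a - h) t₂ D) a h (q - a) ∧
      (idealIII N lam f δ a h (q - a) (a - h) t₂ D).annihilator =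
        idealIII N lam f δ a h (q - a) (a - h) t₂ D := by
  refine S.hasExponents_of_mul_eq_zero (g₁ := f ^ (a - h) * C δ) (g₂ := f ^ t₂ * D) (h₂ := C δ)
    (S.idealIII_mul_eq_zero hh hδ ha haq) (by omega) (by omega) (by omega) hh ?_ ?_ ?_
  · exact Ideal.subset_span (Set.mem_insert _ _)
  · exact Ideal.subset_span (Set.mem_insert_of_mem _ (Set.mem_insert _ _))
  · exact Ideal.subset_span (Set.mem_insert_of_mem _ (Set.mem_insert_of_mem _
      (Set.mem_singleton _)))

end IsSetting

/-- Iterated Frobenius gives `(x^n - α₀)^(p^s) = x^(n p^s) - α₀^(p^s)`. -/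
lemma isSetting_of_card {F : Type*} [Field F] [Fintype F] {p m n s : ℕ} (hp : p.Prime)
    (hF : Fintype.card F = p ^ m) (hn : 1 ≤ n) {α₀ γ : F} (hγ : γ ≠ 0) {f : F[X]}
    (hf : f = X ^ n - C α₀) (hirr : Irreducible f) {lam : ChainRing F}
    (hlam : lam = unitOf (α₀ ^ p ^ s) γ) :
    IsSetting (n * p ^ s) lam f (p ^ s) (α₀ ^ p ^ s) γ := by
  have : Fact p.Prime := ⟨hp⟩
  have : CharP F p := charP_of_card_eq_prime_pow hF
  refine ⟨Nat.mul_ne_zero (by omega) (pow_ne_zero _ hp.ne_zero), ?_, hlam, hγ, hirr⟩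
  rw [hf, sub_pow_char_pow, ← pow_mul, C_pow]

end Constacyclic

theorem mainTheorem10 {F : Type*} [Field F] [Fintype F] (p m n s : ℕ) (hp : p.Prime)
    (hm : 1 ≤ m) (hF : Fintype.card F = p ^ m) (hn : 1 ≤ n) (hs : 1 ≤ s)
    (α₀ γ : F) (hα₀ : α₀ ≠ 0) (hγ : γ ≠ 0)
    (f : F[X]) (hf : f = X ^ n - C α₀) (hirr : Irreducible f)
    (lam : Constacyclic.ChainRing F) (hlam : lam = Constacyclic.unitOf (α₀ ^ p ^ s) γ) :
    -- Type I
    (¬ ∃ K : Submodule (Constacyclic.ChainRing F) (Fin (n * p ^ s) → Constacyclic.ChainRing F),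
      Constacyclic.IsConstacyclic lam K ∧ Constacyclic.IsTypeI f (p ^ s) lam K ∧
        Constacyclic.IsIsodual K) ∧
    -- Type II
    ((∃ K : Submodule (Constacyclic.ChainRing F) (Fin (n * p ^ s) → Constacyclic.ChainRing F),
      Constacyclic.IsConstacyclic lam K ∧ Constacyclic.IsTypeII f (p ^ s) lam K ∧
        Constacyclic.IsIsodual K) ↔ p = 2) ∧
    (p = 2 →
      ∀ K : Submodule (Constacyclic.ChainRing F) (Fin (n * p ^ s) → Constacyclic.ChainRing F),
        (Constacyclic.IsConstacyclic lam K ∧ Constacyclic.IsTypeII f (p ^ s) lam K ∧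
          Constacyclic.IsIsodual K) ↔
        K = Constacyclic.codeOfIdeal
          (Constacyclic.idealII (n * p ^ s) lam f (2 ^ (s - 1)))) ∧
    -- Type III
    ((∃ K : Submodule (Constacyclic.ChainRing F) (Fin (n * p ^ s) → Constacyclic.ChainRing F),
      Constacyclic.IsConstacyclic lam K ∧ Constacyclic.IsTypeIII f (p ^ s) lam K ∧
        Constacyclic.IsIsodual K) ↔ p = 2) ∧
    (p = 2 →
      ∀ a : ℕ, 2 ^ (s - 1) ≤ a → a < 2 ^ s → ∀ (t₂ : ℕ) (D₂ : F[X]),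
        Constacyclic.IsAdmissible (n * p ^ s) lam f (2 ^ s - a) t₂ D₂ →
        ∀ K : Submodule (Constacyclic.ChainRing F)
            (Fin (n * p ^ s) → Constacyclic.ChainRing F),
          K = Constacyclic.codeOfIdeal
            (Constacyclic.idealIII (n * p ^ s) lam f (γ ^ 2 ^ (m - 1)) a (2 ^ (s - 1))
              (2 ^ s - a) (a - 2 ^ (s - 1)) t₂ D₂) →
          Constacyclic.IsConstacyclic lam K ∧ Constacyclic.IsTypeIII f (p ^ s) lam K ∧
            Constacyclic.IsIsodual K) := by
  have S := Constacyclic.isSetting_of_card (s := s) hp hF hn hγ hf hirr hlam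
  have hq : p ^ s ≠ 0 := pow_ne_zero _ hp.ne_zero
  have even : ∀ b, 2 * b = p ^ s → p = 2 := fun b hb =>
    ((Nat.prime_dvd_prime_iff_eq Nat.prime_two hp).mp
      (Nat.prime_two.dvd_of_dvd_pow ⟨b, hb.symm⟩)).symm
  have half : 2 * 2 ^ (s - 1) = 2 ^ s := by
    rw [← pow_succ', Nat.sub_add_cancel hs]
  have typeII : p = 2 →
      ∀ K : Submodule (Constacyclic.ChainRing F) (Fin (n * p ^ s) → Constacyclic.ChainRing F),
        (Constacyclic.IsConstacyclic lam K ∧ Constacyclic.IsTypeII f (p ^ s) lam K ∧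
          Constacyclic.IsIsodual K) ↔
        K = Constacyclic.codeOfIdeal
          (Constacyclic.idealII (n * p ^ s) lam f (2 ^ (s - 1))) := by
    rintro rfl K
    constructor
    · rintro ⟨-, ⟨I, rfl, -, -, b, c, hb, hexp⟩, hiso⟩
      obtain ⟨hac, hbq⟩ := S.exponents_of_isIsodual hexp hiso
      obtain rfl : c = 0 := by omega
      obtain rfl : b = 2 ^ (s - 1) := by omega
      rw [S.eq_idealII_of_hasExponents hexp]
    · rintro rfl
      obtain ⟨hexp, hann⟩ := S.idealII_spec half
      exact ⟨Constacyclic.isConstacyclic_codeOfIdeal S.length_ne_zero _,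
        ⟨_, rfl, S.ne_bot_of_hasExponents hexp (by omega),
          S.ne_top_of_mul_eq_zero hq (S.idealII_mul_eq_zero half), _, _, by omega, hexp⟩,
        Constacyclic.isIsodual_of_eq_annihilator S.length_ne_zero _ hann⟩
  have typeIII : p = 2 →
      ∀ a : ℕ, 2 ^ (s - 1) ≤ a → a < 2 ^ s → ∀ (t₂ : ℕ) (D₂ : F[X]),
        ∀ K : Submodule (Constacyclic.ChainRing F)
            (Fin (n * p ^ s) → Constacyclic.ChainRing F),
          K = Constacyclic.codeOfIdeal
            (Constacyclic.idealIII (n * p ^ s) lam f (γ ^ 2 ^ (m - 1)) a (2 ^ (s - 1))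
              (2 ^ s - a) (a - 2 ^ (s - 1)) t₂ D₂) →
          Constacyclic.IsConstacyclic lam K ∧ Constacyclic.IsTypeIII f (p ^ s) lam K ∧
            Constacyclic.IsIsodual K := by
    rintro rfl a ha haq t₂ D₂ K rfl
    have : Fact (Nat.Prime 2) := ⟨hp⟩
    have : CharP F 2 := charP_of_card_eq_prime_pow hF
    -- The square is `γ^(2^m)`, and `2^m` is the order of the field.
    have hδ : (γ ^ 2 ^ (m - 1)) ^ 2 = γ := by
      rw [← pow_mul, ← pow_succ, Nat.sub_add_cancel hm, ← hF, FiniteField.pow_card]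
    obtain ⟨hexp, hann⟩ := S.idealIII_spec (t₂ := t₂) (D := D₂) half hδ ha haq.le
    exact ⟨Constacyclic.isConstacyclic_codeOfIdeal S.length_ne_zero _,
      ⟨_, rfl, S.ne_bot_of_hasExponents hexp (by omega),
        S.ne_top_of_mul_eq_zero hq (S.idealIII_mul_eq_zero half hδ ha haq.le),
        _, _, _, haq, hexp⟩,
      Constacyclic.isIsodual_of_eq_annihilator S.length_ne_zero _ hann⟩
  refine ⟨?_, ⟨?_, fun h2 => ⟨_, (typeII h2 _).mpr rfl⟩⟩, typeII, ⟨?_, fun h2 => ?_⟩,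
    fun h2 a ha haq t₂ D₂ _ => typeIII h2 a ha haq t₂ D₂⟩
  · rintro ⟨_, -, ⟨I, rfl, -, -, c, hexp⟩, hiso⟩
    have := (S.exponents_of_isIsodual hexp hiso).2
    omega
  · rintro ⟨_, -, ⟨I, rfl, -, -, b, c, -, hexp⟩, hiso⟩
    exact even b (S.exponents_of_isIsodual hexp hiso).2
  · rintro ⟨_, -, ⟨I, rfl, -, -, a, b, c, -, hexp⟩, hiso⟩
    exact even b (S.exponents_of_isIsodual hexp hiso).2
  -- Existence is witnessed by the smallest allowed `a = 2^(s-1)` with `D₂ = 0`.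
  · have := Nat.two_pow_pos (s - 1)
    exact ⟨_, typeIII h2 (2 ^ (s - 1)) le_rfl (by omega) 0 0 _ rfl⟩
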